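/- Let $X$ be a metric space and let $\delta$ be a real number such that $X$ is $\delta$-hyperbolic, i.e. the Gromov product $(x,y)_w=\tfrac12\,(d(x,w)+d(y,w)-d(x,y))$ satisfies $(x,z)_w\ge\min\big((x,y)_w,(y,z)_w\big)-\delta$ for all $x,y,z,w\in X$. Let $\lambda\ge 1$ and $C\ge 0$ be real numbers, and let $Q=f([a,b])$ be a $(\lambda,C)$-quasi-geodesic, where $a\le b$ are real numbers and $f:[a,b]\to X$ is a (not necessarily continuous) map with $$\lambda^{-1}|v-u|-C\le d(f(u),f(v))\le\lambda|v-u|+C\qquad\text{for all }u,v\in[a,b].$$ Let $G$ be a geodesic segment between $f(a)$ and $f(b)$, i.e. the image of an isometric embedding $g:[a',b']\to X$ of a compact interval with $g(a')=f(a)$ and $g(b')=f(b)$. Then the Hausdorff distance between $Q$ and $G$ is finite and satisfies $$HD(Q,G)\le 92\,\lambda^2\,(C+\delta).$$ -/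

import Mathlib

/-- The Gromov product `(x, y)_w = (d(x, w) + d(y, w) - d(x, y)) / 2`, based at `w`. -/
noncomputable def gromovProduct {X : Type*} [MetricSpace X] (w x y : X) : ℝ :=
  (dist x w + dist y w - dist x y) / 2

/-- `X` is `δ`-hyperbolic: `(x, z)_w ≥ min ((x, y)_w) ((y, z)_w) - δ` for all points. -/
def IsGromovHyperbolic (X : Type*) [MetricSpace X] (δ : ℝ) : Prop :=
  ∀ w x y z : X, min (gromovProduct w x y) (gromovProduct w y z) - δ ≤ gromovProduct w x z

/-- `f` is a `(lam, C)`-quasi-isometry on the set `s` of reals; the requirements `lam ≥ 1` and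
`C ≥ 0` are part of the definition. -/
structure IsQuasiIsometryOn {X : Type*} [MetricSpace X] (lam C : ℝ) (f : ℝ → X) (s : Set ℝ) :
    Prop where
  one_le : 1 ≤ lam
  nonneg : 0 ≤ C
  lower : ∀ u ∈ s, ∀ v ∈ s, lam⁻¹ * |v - u| - C ≤ dist (f u) (f v)
  upper : ∀ u ∈ s, ∀ v ∈ s, dist (f u) (f v) ≤ lam * |v - u| + C

/-- `Q` is a `(lam, C)`-quasi-geodesic with endpoints `x` and `y`: the image of a compact interval
`[a, b]` under a `(lam, C)`-quasi-isometry sending `a` to `x` and `b` to `y`. -/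
def IsQuasiGeodesicBetween {X : Type*} [MetricSpace X] (lam C : ℝ) (Q : Set X) (x y : X) : Prop :=
  ∃ (a b : ℝ) (f : ℝ → X), a ≤ b ∧ IsQuasiIsometryOn lam C f (Set.Icc a b) ∧
    f a = x ∧ f b = y ∧ Q = f '' Set.Icc a b

/-- A geodesic segment from `x` to `y` is a `(1, 0)`-quasi-geodesic with these endpoints. -/
def IsGeodesicSegmentBetween {X : Type*} [MetricSpace X] (G : Set X) (x y : X) : Prop :=
  IsQuasiGeodesicBetween 1 0 G x y

/-! Enlarging both constants to `C + δ + ε > 0` (again called δ) makes `f` a coarse embedding into a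
δ-hyperbolic space. The heart is `gromovProduct_le`: for `u ≤ z ≤ u'`, the product of `f u` and `f
u'` at `f z` is at most `62 * lam ^ 2 * δ`. Comparison with points of `G` costs at most 4δ more,
hence 66, which is below 92.

The space need not be geodesic, so the projection of `f z` to a segment from `f u` to `f u'` is
replaced by a virtual point: a function `h` behaving like the distance to the centre of the tripod,
with `h (f z)` equal to the Gromov product. Seen from there, `f u` and `f u'` are opposite to `f z`.
Advance from both ends to parameters `y`, `y'` where the product with `f z` has just become a few δ.
Passing from `(u, u')` to `(y, y')` lowers the Gromov product by at most 6δ. If one of the discarded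
pieces comes near the virtual point, then so does the other; the parameters are then close and `h (f
z)` is bounded directly. Otherwise the piece that stays farther away must be exponentially long
(`one_le_mul_exp_sub_exp`, from a Frink chain inequality), so `exp (-(width) / (32 * lam * δ))`
grows by at least `1 / lam ^ 2`. This quantity is bounded by 1, so the total loss is bounded. -/

theorem IsGromovHyperbolic.four_point {X : Type*} [MetricSpace X] {δ : ℝ}
    (hX : IsGromovHyperbolic X δ) (x y z w : X) :
    dist x z + dist y w ≤ max (dist x y + dist z w) (dist y z + dist x w) + 2 * δ := by
  have h := hX w x y z
  unfold gromovProduct at h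
  rcases min_choice ((dist x w + dist y w - dist x y) / 2)
    ((dist y w + dist z w - dist y z) / 2) with h' | h' <;> rw [h'] at h
  · linarith [le_max_left (dist x y + dist z w) (dist y z + dist x w)]
  · linarith [le_max_right (dist x y + dist z w) (dist y z + dist x w)]

/-! ### Virtual points. -/

/-- The properties of the distance function to a point of a `δ`-hyperbolic extension of `X`. -/
structure IsVirtualPoint {X : Type*} [MetricSpace X] (δ : ℝ) (h : X → ℝ) : Prop where
  lipschitz : ∀ p q, h p ≤ dist p q + h q
  triangle : ∀ p q, dist p q ≤ h p + h q + 2 * δ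
  four_point : ∀ p q r, dist p r + h q ≤ max (dist p q + h r) (dist q r + h p) + 2 * δ

/-- The Gromov product based at a virtual point. -/
noncomputable def virtualProduct {X : Type*} [MetricSpace X] (h : X → ℝ) (p q : X) : ℝ :=
  (h p + h q - dist p q) / 2

theorem virtualProduct_comm {X : Type*} [MetricSpace X] (h : X → ℝ) (p q : X) :
    virtualProduct h p q = virtualProduct h q p := by
  unfold virtualProduct; rw [dist_comm]; ring

/-- The centre of the tripod with endpoints `x`, `y`, `w` is realised by a virtual point. -/
theorem IsGromovHyperbolic.exists_virtualPoint {X : Type*} [MetricSpace X] {δ : ℝ}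
    (hX : IsGromovHyperbolic X δ) (x y w : X) :
    ∃ h : X → ℝ, IsVirtualPoint δ h ∧ h w = gromovProduct w x y ∧
      virtualProduct h x w = 0 ∧ virtualProduct h y w = 0 := by
  set c := gromovProduct x y w with hc
  set e := gromovProduct y x w with he
  have hce : c + e = dist x y := by
    simp only [hc, he, gromovProduct]
    rw [dist_comm y x, dist_comm w x, dist_comm w y]; ring
  have hcw : dist x w = c + gromovProduct w x y := by
    simp only [hc, gromovProduct]; rw [dist_comm y x, dist_comm w x]; ring
  have hew : dist y w = e + gromovProduct w x y := by
    simp only [he, gromovProduct]; rw [dist_comm w y]; ring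
  have hc0 : 0 ≤ c := by
    have := dist_triangle_left y w x
    simp only [hc, gromovProduct]; rw [dist_comm y x, dist_comm w x] at *; linarith
  have he0 : 0 ≤ e := by
    have := dist_triangle_left x w y
    simp only [he, gromovProduct]; rw [dist_comm w y]; rw [dist_comm y x, dist_comm y w] at *
    linarith [dist_comm x y, dist_comm y w]
  have hw : max (dist w x - c) (dist w y - e) = gromovProduct w x y := by
    rw [dist_comm w x, dist_comm w y, hcw, hew]; simp
  -- For a point on a segment from `x` to `y`, at distances `c` and `e` from the ends, this maximum
  -- is the lower bound for the distance from `p` given by the triangle inequality.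
  refine ⟨fun p => max (dist p x - c) (dist p y - e), ⟨?_, ?_, ?_⟩, hw, ?_, ?_⟩
  · intro p q
    refine max_le ?_ ?_
    · linarith [dist_triangle p q x, le_max_left (dist q x - c) (dist q y - e)]
    · linarith [dist_triangle p q y, le_max_right (dist q x - c) (dist q y - e)]
  · intro p q
    have h4 := hX.four_point p x q y
    have h1 := le_max_left (dist p x - c) (dist p y - e)
    have h2 := le_max_right (dist p x - c) (dist p y - e)
    have h3 := le_max_left (dist q x - c) (dist q y - e)
    have h5 := le_max_right (dist q x - c) (dist q y - e)
    rcases max_choice (dist p x + dist q y) (dist x q + dist p y) with h' | h' <;>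
      rw [h'] at h4 <;> linarith [dist_comm x q]
  · intro p q r
    have key : ∀ (a : X) (k : ℝ) (h : X → ℝ), (∀ s, dist s a - k ≤ h s) →
        dist p r + (dist q a - k) ≤ max (dist p q + h r) (dist q r + h p) + 2 * δ := by
      intro a k h hh
      have h4 := hX.four_point p q r a
      have h1 := le_max_left (dist p q + h r) (dist q r + h p)
      have h2 := le_max_right (dist p q + h r) (dist q r + h p)
      rcases max_choice (dist p q + dist r a) (dist q r + dist p a) with h' | h' <;>
        rw [h'] at h4 <;> linarith [hh r, hh p]
    rcases max_choice (dist q x - c) (dist q y - e) with h' | h' <;> simp only [h']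
    · exact key x c (fun p => max (dist p x - c) (dist p y - e)) fun s => le_max_left _ _
    · exact key y e (fun p => max (dist p x - c) (dist p y - e)) fun s => le_max_right _ _
  · simp only [virtualProduct, hw]
    rw [dist_self, max_eq_right (by linarith)]; linarith
  · simp only [virtualProduct, hw]
    rw [dist_self, dist_comm y x, max_eq_left (by linarith)]; linarith

namespace IsVirtualPoint

variable {X : Type*} [MetricSpace X] {δ : ℝ} {h : X → ℝ}

theorem min_sub_le_virtualProduct (hh : IsVirtualPoint δ h) (p q r : X) :
    min (virtualProduct h p q) (virtualProduct h q r) - δ ≤ virtualProduct h p r := by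
  have h4 := hh.four_point p q r
  unfold virtualProduct
  have h1 := min_le_left ((h p + h q - dist p q) / 2) ((h q + h r - dist q r) / 2)
  have h2 := min_le_right ((h p + h q - dist p q) / 2) ((h q + h r - dist q r) / 2)
  rcases max_choice (dist p q + h r) (dist q r + h p) with h' | h' <;> rw [h'] at h4 <;> linarith

theorem virtualProduct_le (hh : IsVirtualPoint δ h) (p q : X) : virtualProduct h p q ≤ h p := by
  have := hh.lipschitz q p
  rw [dist_comm] at this
  unfold virtualProduct; linarith

theorem virtualProduct_sub_le (hh : IsVirtualPoint δ h) (p q w : X) :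
    virtualProduct h p w - virtualProduct h q w ≤ dist p q := by
  have := hh.lipschitz p q
  have := dist_triangle_left q w p
  unfold virtualProduct; linarith

/-- The contribution of a virtual point to the Gromov product at `w` of `p` and `q`. -/
theorem sub_le_gromovProduct (hh : IsVirtualPoint δ h) {p q w : X} {L : ℝ}
    (hp : virtualProduct h p w ≤ L) (hq : virtualProduct h q w ≤ L) :
    h w - L - δ ≤ gromovProduct w p q := by
  have h4 := hh.four_point p w q
  unfold virtualProduct at hp hq
  unfold gromovProduct
  rcases max_choice (dist p w + h q) (dist w q + h p) with h' | h' <;> rw [h'] at h4 <;>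
    linarith [dist_comm w q]

end IsVirtualPoint

/-! ### Chain inequality and exponential length of avoiding paths. -/

/-- A chain inequality of Frink type. -/
theorem le_four_mul_sum_of_quasi_ultrametric {ρ : ℕ → ℕ → ℝ} (h0 : ∀ i j, 0 ≤ ρ i j)
    (h2 : ∀ i j k, ρ i k ≤ 2 * max (ρ i j) (ρ j k))
    (h3 : ∀ i j k l, ρ i l ≤ 2 * max (ρ i j) (max (ρ j k) (ρ k l))) (n : ℕ) :
    ∀ m, ρ m (m + (n + 1)) ≤ 4 * ∑ i ∈ Finset.range (n + 1), ρ (m + i) (m + i + 1) := by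
  induction n using Nat.strong_induction_on with
  | _ n ih =>
  intro m
  set S : ℕ → ℝ := fun k => ∑ i ∈ Finset.range k, ρ (m + i) (m + i + 1) with hS
  have hSs : ∀ k, S (k + 1) = S k + ρ (m + k) (m + k + 1) := fun k => Finset.sum_range_succ _ _
  have hS0 : S 0 = 0 := by simp [hS]
  have hSn : ∀ k, 0 ≤ S k := fun k => Finset.sum_nonneg fun i _ => h0 _ _
  have hmono : Monotone S := monotone_nat_of_le_succ fun k => by
    rw [hSs]; linarith [h0 (m + k) (m + k + 1)]
  -- Cut at the first link where the partial sum reaches half the total: the chains on either side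
  -- have sum at most `S (n + 1) / 2`, so induction bounds each by `2 * S (n + 1)`.
  have hex : ∃ k, S (n + 1) / 2 ≤ S (k + 1) := ⟨n, by linarith [hSn (n + 1)]⟩
  classical
  obtain ⟨k, hk, hkmin⟩ : ∃ k, S (n + 1) / 2 ≤ S (k + 1) ∧ ∀ j < k, S (j + 1) < S (n + 1) / 2 :=
    ⟨Nat.find hex, Nat.find_spec hex, fun j hj => not_le.1 (Nat.find_min hex hj)⟩
  have hkn : k ≤ n := by
    by_contra hlt
    have := hkmin n (not_le.1 hlt)
    linarith [hSn (n + 1)]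
  have hmid : ρ (m + k) (m + k + 1) ≤ S (n + 1) := by
    linarith [hSs k, hSn k, hmono (Nat.succ_le_succ hkn)]
  have hleft : 0 < k → ρ m (m + k) ≤ 2 * S (n + 1) := by
    intro hk0
    obtain ⟨j, rfl⟩ : ∃ j, k = j + 1 := ⟨k - 1, by omega⟩
    have := ih j (by omega) m
    have := hkmin j (by omega)
    simp only [hS] at *
    linarith
  have hright : k < n → ρ (m + k + 1) (m + (n + 1)) ≤ 2 * S (n + 1) := by
    intro hlt
    obtain ⟨j, rfl⟩ : ∃ j, n = k + 1 + j := ⟨n - (k + 1), by omega⟩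
    have h1 := ih j (by omega) (m + k + 1)
    have h5 : S (k + 1 + j + 1) = S (k + 1) +
        ∑ i ∈ Finset.range (j + 1), ρ (m + k + 1 + i) (m + k + 1 + i + 1) := by
      simp only [hS]
      rw [add_assoc (k + 1) j 1, Finset.sum_range_add]
      simp only [add_assoc]
    rw [show m + (k + 1 + j + 1) = m + k + 1 + (j + 1) by ring]
    linarith
  change _ ≤ 4 * S (n + 1)
  have hSpos := hSn (n + 1)
  rcases Nat.eq_zero_or_pos k with rfl | hk0
  · rcases hkn.eq_or_lt with rfl | hlt
    · have : ρ m (m + (0 + 1)) ≤ S (0 + 1) := hmid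
      linarith
    · refine (h2 _ (m + 0 + 1) _).trans ?_
      have := max_le (hmid.trans (by linarith : S (n + 1) ≤ 2 * S (n + 1))) (hright hlt)
      simp only [add_zero] at *
      linarith
  · rcases hkn.eq_or_lt with rfl | hlt
    · refine (h2 _ (m + k) _).trans ?_
      have := max_le (hleft hk0) (hmid.trans (by linarith : S (k + 1) ≤ 2 * S (k + 1)))
      simp only [add_assoc] at *
      linarith
    · refine (h3 _ (m + k) (m + k + 1) _).trans ?_
      have := max_le (hleft hk0)
        (max_le (hmid.trans (by linarith : S (n + 1) ≤ 2 * S (n + 1))) (hright hlt))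
      linarith

theorem exp_half_le_two : Real.exp (1 / 2) ≤ 2 := by
  have h1 : Real.exp (1 / 2) ^ 2 = Real.exp 1 := by
    rw [← Real.exp_nat_mul]; norm_num
  nlinarith [Real.exp_one_lt_d9, Real.exp_pos (1 / 2)]

namespace IsVirtualPoint

variable {X : Type*} [MetricSpace X] {δ : ℝ} {h : X → ℝ}

/-- Splitting a product into three loses at most 2δ, and the scale 4δ turns this loss into the
factor `exp (1 / 2) ≤ 2` that the Frink argument allows. -/
theorem exp_virtualProduct_chain (hh : IsVirtualPoint δ h) (hδ : 0 < δ) (p : ℕ → X) (n : ℕ) :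
    Real.exp (-virtualProduct h (p 0) (p (n + 1)) / (4 * δ)) ≤
      4 * ∑ i ∈ Finset.range (n + 1),
        Real.exp (-virtualProduct h (p i) (p (i + 1)) / (4 * δ)) := by
  have key : ∀ s t c : ℝ, s - c * δ ≤ t → c ≤ 2 →
      Real.exp (-t / (4 * δ)) ≤ 2 * Real.exp (-s / (4 * δ)) := by
    intro s t c hst hc
    refine le_trans ?_ (mul_le_mul_of_nonneg_right exp_half_le_two (Real.exp_pos _).le)
    rw [← Real.exp_add, Real.exp_le_exp]
    have : -t ≤ -s + 2 * δ := by nlinarith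
    calc -t / (4 * δ) ≤ (-s + 2 * δ) / (4 * δ) := by gcongr
      _ = 1 / 2 + -s / (4 * δ) := by field_simp; ring
  have hmin := hh.min_sub_le_virtualProduct
  have h2 : ∀ i j k, Real.exp (-virtualProduct h (p i) (p k) / (4 * δ)) ≤
      2 * max (Real.exp (-virtualProduct h (p i) (p j) / (4 * δ)))
        (Real.exp (-virtualProduct h (p j) (p k) / (4 * δ))) := by
    intro i j k
    have h4 := hmin (p i) (p j) (p k)
    rcases min_choice (virtualProduct h (p i) (p j)) (virtualProduct h (p j) (p k)) with h' | h'
      <;> rw [h'] at h4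
    · exact (key (virtualProduct h (p i) (p j)) _ 1 (by linarith) (by norm_num)).trans
        (mul_le_mul_of_nonneg_left (le_max_left _ _) zero_le_two)
    · exact (key (virtualProduct h (p j) (p k)) _ 1 (by linarith) (by norm_num)).trans
        (mul_le_mul_of_nonneg_left (le_max_right _ _) zero_le_two)
  have h3 : ∀ i j k l, Real.exp (-virtualProduct h (p i) (p l) / (4 * δ)) ≤
      2 * max (Real.exp (-virtualProduct h (p i) (p j) / (4 * δ)))
        (max (Real.exp (-virtualProduct h (p j) (p k) / (4 * δ)))
          (Real.exp (-virtualProduct h (p k) (p l) / (4 * δ)))) := by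
    intro i j k l
    have h4 := hmin (p i) (p j) (p l)
    have h5 := hmin (p j) (p k) (p l)
    rcases min_choice (virtualProduct h (p i) (p j)) (virtualProduct h (p j) (p l)) with h' | h'
      <;> rw [h'] at h4
    · exact (key (virtualProduct h (p i) (p j)) _ 1 (by linarith) (by norm_num)).trans
        (mul_le_mul_of_nonneg_left (le_max_left _ _) zero_le_two)
    · rcases min_choice (virtualProduct h (p j) (p k)) (virtualProduct h (p k) (p l)) with h' | h'
        <;> rw [h'] at h5
      · exact (key (virtualProduct h (p j) (p k)) _ 2 (by linarith) le_rfl).trans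
          (mul_le_mul_of_nonneg_left ((le_max_left _ _).trans (le_max_right _ _)) zero_le_two)
      · exact (key (virtualProduct h (p k) (p l)) _ 2 (by linarith) le_rfl).trans
          (mul_le_mul_of_nonneg_left ((le_max_right _ _).trans (le_max_right _ _)) zero_le_two)
  simpa using le_four_mul_sum_of_quasi_ultrametric
    (ρ := fun i j => Real.exp (-virtualProduct h (p i) (p j) / (4 * δ)))
    (fun _ _ => (Real.exp_pos _).le) h2 h3 n 0

/-- A path which stays far away from a virtual point, but is not seen from there under a small
angle, is exponentially long compared to its distance to the virtual point. -/
theorem one_le_mul_exp_sub_exp (hh : IsVirtualPoint δ h) (hδ : 0 < δ) {lam s e T : ℝ}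
    (hlam : 1 ≤ lam) {p : ℝ → X}
    (hup : ∀ u ∈ Set.Icc s e, ∀ v ∈ Set.Icc s e, dist (p u) (p v) ≤ lam * |v - u| + δ)
    (hlen : δ ≤ lam * (e - s)) (hend : virtualProduct h (p s) (p e) ≤ δ)
    (hfar : ∀ t ∈ Set.Icc s e, 48 * δ ≤ h (p t))
    (hT : ∀ t ∈ Set.Icc s e, T - t ≤ lam * (2 * h (p t) + 3 * δ)) :
    1 ≤ lam ^ 2 * (Real.exp (-(T - e) / (32 * lam * δ)) -
      Real.exp (-(T - s) / (32 * lam * δ))) := by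
  have hlam0 : 0 < lam := by linarith
  -- Subdivide into `n + 1` equal steps `η` with `δ ≤ lam * η ≤ 2 * δ`, so consecutive points of the
  -- path are at distance at most 3δ.
  obtain ⟨n, hn1, hn2⟩ : ∃ n : ℕ, ((n : ℝ) + 1) * δ ≤ lam * (e - s) ∧
      lam * (e - s) ≤ 2 * ((n + 1) * δ) := by
    have h1 : 1 ≤ ⌊lam * (e - s) / δ⌋₊ := Nat.le_floor (by rw [Nat.cast_one, le_div_iff₀ hδ]; linarith)
    refine ⟨⌊lam * (e - s) / δ⌋₊ - 1, ?_, ?_⟩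
    · have h2 := Nat.floor_le (a := lam * (e - s) / δ) (by apply div_nonneg <;> linarith)
      rw [le_div_iff₀ hδ] at h2
      rw [Nat.cast_sub h1]; push_cast; linarith
    · have h2 := Nat.lt_floor_add_one (lam * (e - s) / δ)
      rw [div_lt_iff₀ hδ] at h2
      have h3 : (1 : ℝ) ≤ ⌊lam * (e - s) / δ⌋₊ := by exact_mod_cast h1
      rw [Nat.cast_sub h1]; push_cast
      nlinarith
  have hn0 : (0 : ℝ) < n + 1 := by positivity
  obtain ⟨η, hη⟩ : ∃ η, ((n : ℝ) + 1) * η = e - s := ⟨(e - s) / (n + 1), by field_simp⟩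
  have hη1 : δ ≤ lam * η := by
    refine le_of_mul_le_mul_left ?_ hn0
    calc _ ≤ lam * (e - s) := hn1
      _ = _ := by rw [← hη]; ring
  have hη2 : lam * η ≤ 2 * δ := by
    refine le_of_mul_le_mul_left ?_ hn0
    calc _ = lam * (e - s) := by rw [← hη]; ring
      _ ≤ _ := hn2
      _ = _ := by ring
  have hη0 : 0 < η := pos_of_mul_pos_right (hδ.trans_le hη1) hlam0.le
  set τ : ℕ → ℝ := fun i => s + i * η with hτ
  have hτmem : ∀ i ≤ n + 1, τ i ∈ Set.Icc s e := by
    intro i hi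
    have hi' : (i : ℝ) ≤ n + 1 := by exact_mod_cast hi
    have : (i : ℝ) * η ≤ (n + 1) * η := by gcongr
    have : 0 ≤ (i : ℝ) * η := by positivity
    constructor <;> simp only [hτ] <;> linarith
  set F : ℕ → ℝ := fun i => Real.exp (-(T - τ i) / (32 * lam * δ)) with hF
  -- Comparison of a Riemann sum with the integral of an exponential; the sum of the `F i` then
  -- telescopes.
  have hstep : ∀ i, F i ≤ 32 * lam ^ 2 * (F (i + 1) - F i) := by
    intro i
    have h1 : F (i + 1) = F i * Real.exp (η / (32 * lam * δ)) := by
      simp only [hF, hτ]; rw [← Real.exp_add]; congr 1; push_cast; ring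
    have h2 := Real.add_one_le_exp (η / (32 * lam * δ))
    have h3 : 1 ≤ 32 * lam ^ 2 * (η / (32 * lam * δ)) := by
      have : 32 * lam ^ 2 * (η / (32 * lam * δ)) = lam * η / δ := by field_simp
      rw [this, le_div_iff₀ hδ]; linarith
    have h4 : 0 < F i := Real.exp_pos _
    have h5 : 1 ≤ 32 * lam ^ 2 * (Real.exp (η / (32 * lam * δ)) - 1) :=
      h3.trans (by gcongr; linarith)
    rw [h1]
    nlinarith
  have hterm : ∀ i < n + 1, Real.exp (-virtualProduct h (p (τ i)) (p (τ (i + 1))) / (4 * δ)) ≤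
      Real.exp (-(33 / 4) + 3 / 32) * F i := by
    intro i hi
    have hi1 := hτmem i hi.le
    have hi2 := hτmem (i + 1) hi
    have hd := hup _ hi1 _ hi2
    have : τ (i + 1) - τ i = η := by simp only [hτ]; push_cast; ring
    rw [this, abs_of_pos hη0] at hd
    have hl := hh.lipschitz (p (τ i)) (p (τ (i + 1)))
    have hv : h (p (τ i)) - 3 * δ ≤ virtualProduct h (p (τ i)) (p (τ (i + 1))) := by
      unfold virtualProduct; linarith
    have hf := hfar _ hi1
    have ht := hT _ hi1
    simp only [hF]
    rw [← Real.exp_add, Real.exp_le_exp]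
    have e1 : -(T - τ i) / (32 * lam * δ) ≥ -(2 * h (p (τ i)) + 3 * δ) / (32 * δ) := by
      rw [ge_iff_le, div_le_div_iff₀ (by positivity) (by positivity)]
      nlinarith
    have e2 : -virtualProduct h (p (τ i)) (p (τ (i + 1))) / (4 * δ) ≤
        -(h (p (τ i)) - 3 * δ) / (4 * δ) := by gcongr
    -- Only part of the decay in `h` is traded for decay in the parameter; at `h = 48 * δ` the
    -- remainder is exactly `33 / 4 - 3 / 32`, enough to absorb the factor `128 = 4 * 32` below.
    have e3 : -(h (p (τ i)) - 3 * δ) / (4 * δ) ≤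
        -(33 / 4) + 3 / 32 + -(2 * h (p (τ i)) + 3 * δ) / (32 * δ) := by
      have : -(33 / 4) + 3 / 32 + -(2 * h (p (τ i)) + 3 * δ) / (32 * δ) -
        -(h (p (τ i)) - 3 * δ) / (4 * δ) = 3 * (h (p (τ i)) - 48 * δ) / (16 * δ) := by
          field_simp; ring
      have : 0 ≤ 3 * (h (p (τ i)) - 48 * δ) / (16 * δ) :=
        div_nonneg (by linarith) (by positivity)
      linarith
    linarith
  have hchain := hh.exp_virtualProduct_chain hδ (fun i => p (τ i)) n
  have hτ0 : τ 0 = s := by simp [hτ]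
  have hτn : τ (n + 1) = e := by simp only [hτ]; push_cast; linarith
  have hsum : ∑ i ∈ Finset.range (n + 1),
      Real.exp (-virtualProduct h (p (τ i)) (p (τ (i + 1))) / (4 * δ)) ≤
      Real.exp (-(33 / 4) + 3 / 32) * (32 * lam ^ 2 * (F (n + 1) - F 0)) := by
    calc _ ≤ ∑ i ∈ Finset.range (n + 1),
          Real.exp (-(33 / 4) + 3 / 32) * (32 * lam ^ 2 * (F (i + 1) - F i)) :=
        Finset.sum_le_sum fun i hi => (hterm i (Finset.mem_range.1 hi)).trans
          (by gcongr; exact hstep i)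
      _ = _ := by rw [← Finset.mul_sum, ← Finset.mul_sum, Finset.sum_range_sub]
  simp only [hτ0, hτn] at hchain
  have hlow : Real.exp (-(1 / 4)) ≤ Real.exp (-virtualProduct h (p s) (p e) / (4 * δ)) := by
    rw [Real.exp_le_exp, le_div_iff₀ (by positivity)]; linarith
  have hFs : F (n + 1) - F 0 = Real.exp (-(T - e) / (32 * lam * δ)) -
      Real.exp (-(T - s) / (32 * lam * δ)) := by simp only [hF, hτ0, hτn]
  rw [← hFs]
  have hexp : 128 * Real.exp (-(33 / 4) + 3 / 32) ≤ Real.exp (-(1 / 4)) := by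
    have h7 : (128 : ℝ) ≤ Real.exp 7 := by
      have : Real.exp 7 = Real.exp 1 ^ 7 := by rw [← Real.exp_nat_mul]; norm_num
      rw [this]
      calc (128 : ℝ) = 2 ^ 7 := by norm_num
        _ ≤ _ := by gcongr; linarith [Real.exp_one_gt_d9]
    calc _ ≤ Real.exp 7 * Real.exp (-(33 / 4) + 3 / 32) := by gcongr
      _ ≤ _ := by rw [← Real.exp_add, Real.exp_le_exp]; norm_num
  have hpos := Real.exp_pos (-(33 / 4) + 3 / 32)
  have hfin : Real.exp (-(33 / 4) + 3 / 32) * 1 ≤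
      Real.exp (-(33 / 4) + 3 / 32) * (lam ^ 2 * (F (n + 1) - F 0)) := by linarith
  exact le_of_mul_le_mul_left hfin hpos

end IsVirtualPoint

/-! ### Coarse embeddings and the exit from the region opposite to the base point. -/

/-- An intermediate value property for functions with jumps of size at most `c`. -/
theorem exists_crossing {φ : ℝ → ℝ} {u z μ c L ε : ℝ} (huz : u ≤ z) (hμ : 0 < μ) (hε : 0 < ε)
    (hc : 0 ≤ c) (hφ : ∀ s ∈ Set.Icc u z, ∀ t ∈ Set.Icc u z, φ s - φ t ≤ μ * |t - s| + c)
    (hu : φ u ≤ L) (hz : L ≤ φ z) :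
    ∃ y ∈ Set.Icc u z, (∀ t ∈ Set.Icc u y, φ t ≤ L) ∧ L - c - ε ≤ φ y := by
  by_cases hzT : ∀ t ∈ Set.Icc u z, φ t ≤ L
  · exact ⟨z, ⟨huz, le_rfl⟩, hzT, by linarith⟩
  set S : Set ℝ := {y | y ∈ Set.Icc u z ∧ ∀ t ∈ Set.Icc u y, φ t ≤ L} with hS
  have huS : u ∈ S := ⟨⟨le_rfl, huz⟩, fun t ht => by rw [le_antisymm ht.2 ht.1]; exact hu⟩
  have hbdd : BddAbove S := ⟨z, fun y hy => hy.1.2⟩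
  have hη : 0 < ε / (2 * μ) := by positivity
  -- The supremum itself may fail to lie in `S`, as `φ` may jump. A point of `S` just below it is
  -- within `ε / μ` of a parameter where `φ` exceeds `L`.
  obtain ⟨y, hyS, hy⟩ := exists_lt_of_lt_csSup ⟨u, huS⟩ (sub_lt_self (sSup S) hη)
  have hle := le_csSup hbdd hyS
  have hnot : min (sSup S + ε / (2 * μ)) z ∉ S := by
    rcases min_choice (sSup S + ε / (2 * μ)) z with h' | h' <;> rw [h']
    · intro hmem
      linarith [le_csSup hbdd hmem]
    · exact fun hmem => hzT hmem.2
  have hmem : min (sSup S + ε / (2 * μ)) z ∈ Set.Icc u z :=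
    ⟨le_min (by linarith [hyS.1.1]) huz, min_le_right _ _⟩
  have : ∃ t ∈ Set.Icc u (min (sSup S + ε / (2 * μ)) z), L < φ t := by
    by_contra! hcon
    exact hnot ⟨hmem, hcon⟩
  obtain ⟨t, ht, hLt⟩ := this
  have hyt : y < t := by
    by_contra! hty
    exact absurd (hyS.2 t ⟨ht.1, hty⟩) (not_le.2 hLt)
  have htz : t ≤ z := ht.2.trans (min_le_right _ _)
  have hts : t ≤ sSup S + ε / (2 * μ) := ht.2.trans (min_le_left _ _)
  refine ⟨y, hyS.1, hyS.2, ?_⟩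
  have h1 := hφ t ⟨ht.1, htz⟩ y hyS.1
  rw [abs_sub_comm, abs_of_pos (by linarith)] at h1
  have h2 : μ * (t - y) ≤ μ * (2 * (ε / (2 * μ))) := by gcongr; linarith
  have h3 : μ * (2 * (ε / (2 * μ))) = ε := by field_simp
  linarith

/-- `f` is a quasi-isometric embedding of `s`, with additive error `δ` on both sides. -/
structure IsCoarseEmbeddingOn {X : Type*} [MetricSpace X] (lam δ : ℝ) (f : ℝ → X) (s : Set ℝ) :
    Prop where
  upper : ∀ u ∈ s, ∀ v ∈ s, dist (f u) (f v) ≤ lam * |v - u| + δ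
  lower : ∀ u ∈ s, ∀ v ∈ s, |v - u| ≤ lam * (dist (f u) (f v) + δ)

namespace IsCoarseEmbeddingOn

variable {X : Type*} [MetricSpace X] {lam δ : ℝ} {f : ℝ → X}

theorem mono {s t : Set ℝ} (hf : IsCoarseEmbeddingOn lam δ f t) (hst : s ⊆ t) :
    IsCoarseEmbeddingOn lam δ f s :=
  ⟨fun u hu v hv => hf.upper u (hst hu) v (hst hv),
    fun u hu v hv => hf.lower u (hst hu) v (hst hv)⟩

theorem comp_neg {a b : ℝ} (hf : IsCoarseEmbeddingOn lam δ f (Set.Icc a b)) :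
    IsCoarseEmbeddingOn lam δ (fun t => f (-t)) (Set.Icc (-b) (-a)) := by
  have hm : ∀ u ∈ Set.Icc (-b) (-a), -u ∈ Set.Icc a b := fun u hu =>
    ⟨by linarith [hu.2], by linarith [hu.1]⟩
  have habs : ∀ u v : ℝ, |v - u| = |-v - -u| := fun u v => by
    rw [← abs_neg]; congr 1; ring
  exact ⟨fun u hu v hv => by rw [habs]; exact hf.upper _ (hm u hu) _ (hm v hv),
    fun u hu v hv => by rw [habs]; exact hf.lower _ (hm u hu) _ (hm v hv)⟩

/-- Going from `u` to `z`, one leaves the region seen from a virtual point under a small angle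
with `f u`. -/
theorem exists_exit {h : X → ℝ} (hh : IsVirtualPoint δ h) (hδ : 0 < δ) (hlam : 1 ≤ lam) {u z : ℝ}
    (huz : u ≤ z) (hf : IsCoarseEmbeddingOn lam δ f (Set.Icc u z))
    (hu : virtualProduct h (f u) (f z) = 0) (hz : 5 * δ ≤ h (f z)) :
    ∃ y ∈ Set.Icc u z, (∀ t ∈ Set.Icc u y, virtualProduct h (f t) (f z) ≤ 5 * δ) ∧
      2 * δ ≤ virtualProduct h (f y) (f z) ∧ δ ≤ lam * (y - u) := by
  obtain ⟨y, hy, h1, h2⟩ := exists_crossing (φ := fun t => virtualProduct h (f t) (f z))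
    (μ := lam) (c := δ) (L := 5 * δ) (ε := 2 * δ) huz (by linarith) (by linarith) hδ.le
    (fun s hs t ht => (hh.virtualProduct_sub_le _ _ _).trans (hf.upper s hs t ht))
    (by simp only [hu]; linarith) (by simp only [virtualProduct, dist_self]; linarith)
  refine ⟨y, hy, h1, by linarith, ?_⟩
  have h3 := hh.virtualProduct_sub_le (f y) (f u) (f z)
  have h4 := hf.upper y hy u ⟨le_rfl, huz⟩
  rw [abs_sub_comm, abs_of_nonneg (by linarith [hy.1])] at h4
  linarith

/-- The dichotomy in the induction, when the left part of the path is farther away from the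
virtual point than the right part. -/
theorem bound_or_gain {h : X → ℝ} (hh : IsVirtualPoint δ h) (hδ : 0 < δ) (hlam : 1 ≤ lam)
    {u y z y' u' : ℝ} (huy : u ≤ y) (hyz : y ≤ z) (hzy' : z ≤ y') (hyu' : y' ≤ u')
    (hf : IsCoarseEmbeddingOn lam δ f (Set.Icc u u'))
    (hu : virtualProduct h (f u) (f z) = 0)
    (hl : ∀ t ∈ Set.Icc u y, virtualProduct h (f t) (f z) ≤ 5 * δ)
    (hr : ∀ t ∈ Set.Icc y' u', virtualProduct h (f t) (f z) ≤ 5 * δ)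
    (hy : 2 * δ ≤ virtualProduct h (f y) (f z)) (hlen : δ ≤ lam * (y - u))
    (hdom : ∀ t ∈ Set.Icc u y, ∃ t' ∈ Set.Icc y' u', h (f t') ≤ h (f t)) :
    h (f z) ≤ 56 * lam ^ 2 * δ ∨
      1 ≤ lam ^ 2 * (Real.exp (-(y' - y) / (32 * lam * δ)) -
        Real.exp (-(u' - u) / (32 * lam * δ))) := by
  have hlam0 : 0 < lam := by linarith
  have hwidth : ∀ t ∈ Set.Icc u y, ∀ t' ∈ Set.Icc y' u', h (f t') ≤ h (f t) →
      t' - t ≤ lam * (2 * h (f t) + 3 * δ) := by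
    intro t ht t' ht' hle
    have h1 := hf.lower t ⟨ht.1, by linarith [ht.2]⟩ t' ⟨by linarith [ht'.1], ht'.2⟩
    rw [abs_of_nonneg (by linarith [ht.2, ht'.1])] at h1
    exact h1.trans (mul_le_mul_of_nonneg_left (by linarith [hh.triangle (f t) (f t')]) hlam0.le)
  -- If the left part enters the ball of radius 48δ, domination makes the right part do so too. The
  -- two parameters differ by at most `99 * lam * δ`, and `z` is within half of this of one of them:
  -- 49.5 + 1 + 5 ≤ 56.
  by_cases hnear : ∃ t ∈ Set.Icc u y, h (f t) ≤ 48 * δ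
  · left
    obtain ⟨t, ht, htD⟩ := hnear
    obtain ⟨t', ht', hle⟩ := hdom t ht
    have hw := hwidth t ht t' ht' hle
    have hw' : t' - t ≤ lam * (99 * δ) := hw.trans (by gcongr; linarith)
    have hzm : z ∈ Set.Icc u u' := ⟨by linarith, by linarith⟩
    have hclose : ∀ s ∈ Set.Icc u u', virtualProduct h (f s) (f z) ≤ 5 * δ →
        |z - s| ≤ lam * (99 * δ) / 2 → h (f z) ≤ 56 * lam ^ 2 * δ := by
      intro s hs hv hzs
      have h1 := hf.upper s hs z hzm
      have h2 : lam * |z - s| ≤ lam * (lam * (99 * δ) / 2) := by gcongr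
      have h3 := hh.virtualProduct_le (f s) (f z)
      have h4 : h (f z) ≤ dist (f s) (f z) + 5 * δ := by
        unfold virtualProduct at *; linarith
      have h5 : 1 * δ ≤ lam ^ 2 * δ := by gcongr; nlinarith
      nlinarith
    rcases le_total (z - t) (t' - z) with hc | hc
    · refine hclose t ⟨ht.1, by linarith [ht.2]⟩ (hl t ht) ?_
      rw [abs_of_nonneg (by linarith [ht.2])]; linarith
    · refine hclose t' ⟨by linarith [ht'.1], ht'.2⟩ (hr t' ht') ?_
      rw [abs_sub_comm, abs_of_nonneg (by linarith [ht'.1])]; linarith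
  · right
    push Not at hnear
    -- The product of `f u` with `f z` vanishes while that of `f y` is at least 2δ, so hyperbolicity
    -- forces `f u` and `f y` to be nearly opposite.
    have hend : virtualProduct h (f u) (f y) ≤ δ := by
      have h1 := hh.min_sub_le_virtualProduct (f u) (f y) (f z)
      rw [hu] at h1
      by_contra! hcon
      have : δ < min (virtualProduct h (f u) (f y)) (virtualProduct h (f y) (f z)) :=
        lt_min hcon (by linarith)
      linarith
    have hg := hh.one_le_mul_exp_sub_exp hδ (T := y') hlam
      (hf.mono (Set.Icc_subset_Icc_right (by linarith))).upper hlen hend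
      (fun t ht => (hnear t ht).le) (fun t ht => by
        obtain ⟨t', ht', hle⟩ := hdom t ht
        linarith [hwidth t ht t' ht' hle, ht'.1])
    refine hg.trans ?_
    gcongr

/-! ### Induction on nested parameter intervals. -/

/-- One step of the induction. -/
theorem bound_or_step (hX : IsGromovHyperbolic X δ) (hδ : 0 < δ) (hlam : 1 ≤ lam) {u z u' : ℝ}
    (huz : u ≤ z) (hzu : z ≤ u') (hf : IsCoarseEmbeddingOn lam δ f (Set.Icc u u')) :
    gromovProduct (f z) (f u) (f u') ≤ 56 * lam ^ 2 * δ ∨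
      ∃ y ∈ Set.Icc u z, ∃ y' ∈ Set.Icc z u', δ ≤ lam * (y - u) ∧
        gromovProduct (f z) (f u) (f u') ≤ gromovProduct (f z) (f y) (f y') + 6 * δ ∧
        1 ≤ lam ^ 2 * (Real.exp (-(y' - y) / (32 * lam * δ)) -
          Real.exp (-(u' - u) / (32 * lam * δ))) := by
  obtain ⟨h, hh, hw, hx, hy⟩ := hX.exists_virtualPoint (f u) (f u') (f z)
  rw [← hw]
  by_cases hsmall : h (f z) ≤ 56 * lam ^ 2 * δ
  · exact Or.inl hsmall
  have hbig : 5 * δ ≤ h (f z) := by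
    have : 1 * δ ≤ lam ^ 2 * δ := by gcongr; nlinarith
    linarith
  have hfn : IsCoarseEmbeddingOn lam δ (fun t => f (-t)) (Set.Icc (-u') (-u)) := hf.comp_neg
  obtain ⟨y, hym, hyl, hy2, hylen⟩ := exists_exit hh hδ hlam huz
    (hf.mono (Set.Icc_subset_Icc_right hzu)) hx hbig
  obtain ⟨y', hym', hyl', hy2', hylen'⟩ := exists_exit (u := -u') (z := -z) hh hδ hlam
    (by linarith) (hfn.mono (Set.Icc_subset_Icc_right (by linarith)))
    (by simpa using hy) (by simpa using hbig)
  simp only [neg_neg] at hyl' hy2'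
  have hr : ∀ t ∈ Set.Icc (-y') u', virtualProduct h (f t) (f z) ≤ 5 * δ := fun t ht => by
    simpa using hyl' (-t) ⟨by linarith [ht.2], by linarith [ht.1]⟩
  have hz1 : z ≤ -y' := by linarith [hym'.2]
  have hz2 : -y' ≤ u' := by linarith [hym'.1]
  have hgain : 1 ≤ lam ^ 2 * (Real.exp (-(-y' - y) / (32 * lam * δ)) -
          Real.exp (-(u' - u) / (32 * lam * δ))) := by
    -- Either every left point is dominated by some right point, or one left point `t₀` is closer
    -- than all right points; in the latter case reversing the parameter exchanges the roles.
    by_cases hdom : ∀ t ∈ Set.Icc u y, ∃ t' ∈ Set.Icc (-y') u', h (f t') ≤ h (f t)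
    · exact (bound_or_gain hh hδ hlam hym.1 hym.2 hz1 hz2 hf hx hyl hr hy2 hylen
        hdom).resolve_left hsmall
    · push Not at hdom
      obtain ⟨t₀, ht₀, hlt⟩ := hdom
      have hg := (bound_or_gain (f := fun t => f (-t)) (u := -u') (y := y') (z := -z) (y' := -y)
        (u' := -u) hh hδ hlam hym'.1 hym'.2 (by linarith [hym.2]) (by linarith [hym.1]) hfn
        (by simpa using hy) (by simpa using hyl')
        (fun t ht => by simpa using hyl (-t) ⟨by linarith [ht.2], by linarith [ht.1]⟩)
        (by simpa using hy2') hylen'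
        (fun t ht => ⟨-t₀, ⟨by linarith [ht₀.2], by linarith [ht₀.1]⟩, by
          simpa using (hlt (-t) ⟨by linarith [ht.2], by linarith [ht.1]⟩).le⟩)).resolve_left
          (by simpa using hsmall)
      rwa [show -y - y' = -y' - y by ring, show -u - -u' = u' - u by ring] at hg
  refine Or.inr ⟨y, hym, -y', ⟨hz1, hz2⟩, hylen, ?_, hgain⟩
  linarith [hh.sub_le_gromovProduct (hyl y ⟨hym.1, le_rfl⟩) (hr (-y') ⟨le_rfl, hz2⟩)]

/-- The exponential is a potential: each step loses 6δ in the Gromov product and raises the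
subtracted term by at least 6δ. The constant is 62 = 56 + 6 since the potential is at most `6 * lam
^ 2 * δ`. The induction ends because each step shortens the interval by at least `δ / lam`. -/
theorem gromovProduct_le_sub_exp (hX : IsGromovHyperbolic X δ) (hδ : 0 < δ) (hlam : 1 ≤ lam)
    {z : ℝ} (n : ℕ) : ∀ u u', u ≤ z → z ≤ u' → IsCoarseEmbeddingOn lam δ f (Set.Icc u u') →
      lam * (u' - u) ≤ n * δ → gromovProduct (f z) (f u) (f u') ≤
        62 * lam ^ 2 * δ - 6 * lam ^ 2 * δ * Real.exp (-(u' - u) / (32 * lam * δ)) := by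
  have hbase : ∀ u u', u ≤ z → z ≤ u' →
      56 * lam ^ 2 * δ ≤
        62 * lam ^ 2 * δ - 6 * lam ^ 2 * δ * Real.exp (-(u' - u) / (32 * lam * δ)) := by
    intro u u' h1 h2
    have h3 : Real.exp (-(u' - u) / (32 * lam * δ)) ≤ 1 := by
      rw [Real.exp_le_one_iff]
      exact div_nonpos_of_nonpos_of_nonneg (by linarith) (by positivity)
    have h4 : 0 ≤ 6 * lam ^ 2 * δ := by positivity
    nlinarith
  induction n with
  | zero =>
    intro u u' h1 h2 hf hn
    rcases bound_or_step hX hδ hlam h1 h2 hf with h | ⟨y, hy, y', hy', hlen, -⟩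
    · exact h.trans (hbase u u' h1 h2)
    · have : lam * (y - u) ≤ lam * (u' - u) := by gcongr; linarith [hy.2]
      simp only [Nat.cast_zero, zero_mul] at hn
      linarith
  | succ n ih =>
    intro u u' h1 h2 hf hn
    rcases bound_or_step hX hδ hlam h1 h2 hf with h | ⟨y, hy, y', hy', hlen, hg, hexp⟩
    · exact h.trans (hbase u u' h1 h2)
    · have h3 : lam * (y' - y) ≤ lam * (u' - u) - δ := by
        have : lam * (y' - y) ≤ lam * (u' - y) := by gcongr; exact hy'.2
        linarith
      push_cast at hn
      have h4 := ih y y' hy.2 hy'.1 (hf.mono (Set.Icc_subset_Icc hy.1 hy'.2)) (by linarith)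
      have h5 := mul_le_mul_of_nonneg_left hexp (by positivity : 0 ≤ 6 * δ)
      linarith

theorem gromovProduct_le (hX : IsGromovHyperbolic X δ) (hδ : 0 < δ) (hlam : 1 ≤ lam)
    {u z u' : ℝ} (huz : u ≤ z) (hzu : z ≤ u')
    (hf : IsCoarseEmbeddingOn lam δ f (Set.Icc u u')) :
    gromovProduct (f z) (f u) (f u') ≤ 62 * lam ^ 2 * δ := by
  obtain ⟨n, hn⟩ := exists_nat_ge (lam * (u' - u) / δ)
  rw [div_le_iff₀ hδ] at hn
  refine (gromovProduct_le_sub_exp hX hδ hlam n u u' huz hzu hf hn).trans ?_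
  have : 0 ≤ 6 * lam ^ 2 * δ * Real.exp (-(u' - u) / (32 * lam * δ)) := by positivity
  linarith

end IsCoarseEmbeddingOn

/-! ### From Gromov products to the distance to a geodesic. -/

/-- In a hyperbolic space, a point `w` is close to any point `p` of a geodesic from `x` to `y` which
is almost as far away from the endpoints as the projection of `w`. -/
theorem IsGromovHyperbolic.dist_le_of_abs_sub_le {X : Type*} [MetricSpace X] {δ : ℝ}
    (hX : IsGromovHyperbolic X δ) {x y w p : X} {κ : ℝ} (hp : dist x p + dist p y = dist x y)
    (hκ : |(dist w x - dist w y) - (dist x p - dist p y)| ≤ 2 * κ) :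
    dist w p ≤ gromovProduct w x y + κ + 2 * δ := by
  have h4 := hX.four_point w x p y
  rw [abs_le] at hκ
  unfold gromovProduct
  rw [dist_comm x w, dist_comm y w]
  rcases max_choice (dist w x + dist p y) (dist x p + dist w y) with h' | h' <;> rw [h'] at h4 <;>
    linarith [hκ.1, hκ.2]

theorem IsGeodesicSegmentBetween.exists_dist_eq {X : Type*} [MetricSpace X] {G : Set X} {x y : X}
    (hG : IsGeodesicSegmentBetween G x y) {r : ℝ} (h0 : 0 ≤ r) (hr : r ≤ dist x y) :
    ∃ p ∈ G, dist x p = r ∧ dist p y = dist x y - r := by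
  obtain ⟨a, b, g, hab, hg, rfl, rfl, rfl⟩ := hG
  have hd : ∀ u ∈ Set.Icc a b, ∀ v ∈ Set.Icc a b, u ≤ v → dist (g u) (g v) = v - u := by
    intro u hu v hv huv
    have h1 := hg.lower u hu v hv
    have h2 := hg.upper u hu v hv
    rw [abs_of_nonneg (by linarith)] at h1 h2
    simp only [inv_one] at h1
    linarith
  have ha : a ∈ Set.Icc a b := ⟨le_rfl, hab⟩
  have hb : b ∈ Set.Icc a b := ⟨hab, le_rfl⟩
  have hab' := hd a ha b hb hab
  have hm : a + r ∈ Set.Icc a b := ⟨by linarith, by linarith⟩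
  refine ⟨g (a + r), ⟨_, hm, rfl⟩, ?_, ?_⟩
  · rw [hd a ha _ hm hm.1]; ring
  · rw [hd _ hm b hb hm.2, hab']; ring

theorem IsGeodesicSegmentBetween.dist_add_dist {X : Type*} [MetricSpace X] {G : Set X} {x y p : X}
    (hG : IsGeodesicSegmentBetween G x y) (hp : p ∈ G) : dist x p + dist p y = dist x y := by
  obtain ⟨a, b, g, hab, hg, rfl, rfl, rfl⟩ := hG
  obtain ⟨t, ht, rfl⟩ := hp
  have h1 := hg.upper a ⟨le_rfl, hab⟩ t ht
  have h2 := hg.upper t ht b ⟨hab, le_rfl⟩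
  have h3 := hg.lower a ⟨le_rfl, hab⟩ b ⟨hab, le_rfl⟩
  rw [abs_of_nonneg (by linarith [ht.1])] at h1
  rw [abs_of_nonneg (by linarith [ht.2])] at h2
  rw [abs_of_nonneg (by linarith)] at h3
  simp only [inv_one] at h3
  linarith [dist_triangle (g a) (g t) (g b)]

/-- The Morse lemma: a coarsely embedded interval and a geodesic with the same endpoints are close
to each other. -/
theorem IsCoarseEmbeddingOn.exists_dist_le {X : Type*} [MetricSpace X] {lam δ : ℝ} {f : ℝ → X}
    (hX : IsGromovHyperbolic X δ) (hδ : 0 < δ) (hlam : 1 ≤ lam) {a b : ℝ} (hab : a ≤ b)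
    (hf : IsCoarseEmbeddingOn lam δ f (Set.Icc a b)) {G : Set X}
    (hG : IsGeodesicSegmentBetween G (f a) (f b)) :
    (∀ q ∈ f '' Set.Icc a b, ∃ p ∈ G, dist q p ≤ 66 * lam ^ 2 * δ) ∧
      ∀ p ∈ G, ∃ q ∈ f '' Set.Icc a b, dist p q ≤ 66 * lam ^ 2 * δ := by
  have h1 : 1 * δ ≤ lam ^ 2 * δ := by gcongr; nlinarith
  have hprod : ∀ t ∈ Set.Icc a b, gromovProduct (f t) (f a) (f b) ≤ 62 * lam ^ 2 * δ :=
    fun t ht => IsCoarseEmbeddingOn.gromovProduct_le hX hδ hlam ht.1 ht.2 hf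
  constructor
  · rintro _ ⟨t, ht, rfl⟩
    obtain ⟨p, hp, hp1, hp2⟩ := hG.exists_dist_eq
      (r := (dist (f a) (f b) + dist (f t) (f a) - dist (f t) (f b)) / 2)
      (by linarith [dist_triangle (f t) (f a) (f b)])
      (by linarith [dist_triangle_left (f a) (f b) (f t), dist_triangle (f t) (f b) (f a),
        dist_comm (f a) (f b)])
    refine ⟨p, hp, ?_⟩
    have := hX.dist_le_of_abs_sub_le (w := f t) (κ := 0) (hG.dist_add_dist hp)
      (by rw [hp1, hp2]; ring_nf; simp)
    linarith [hprod t ht]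
  · intro p hp
    have hadd := hG.dist_add_dist hp
    -- Look for a parameter whose image projects near `p`: the difference of distances to the
    -- endpoints has jumps of at most 2δ, so it matches that of `p` up to 4δ, giving `κ = 2 * δ`.
    obtain ⟨t, ht, hle, hge⟩ := exists_crossing (φ := fun t => dist (f t) (f a) - dist (f t) (f b))
      (u := a) (z := b) (μ := 2 * lam) (c := 2 * δ) (ε := 2 * δ)
      (L := dist (f a) p - dist p (f b)) hab (by linarith) (by linarith) (by linarith)
      (fun s hs t ht => by
        have h2 := hf.upper s hs t ht
        have h3 := dist_triangle (f s) (f t) (f a)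
        have h4 := dist_triangle_left (f t) (f b) (f s)
        linarith)
      (by simp only [dist_self]; linarith [dist_nonneg (x := f a) (y := p)])
      (by simp only [dist_self]; linarith [dist_nonneg (x := p) (y := f b), dist_comm (f a) (f b)])
    refine ⟨f t, ⟨t, ht, rfl⟩, ?_⟩
    have h2 := hle t ⟨ht.1, le_rfl⟩
    have h3 := hX.dist_le_of_abs_sub_le (w := f t) (κ := 2 * δ) hadd
      (by rw [abs_le]; constructor <;> linarith)
    rw [dist_comm]
    linarith [hprod t ht]

theorem IsQuasiIsometryOn.isCoarseEmbeddingOn {X : Type*} [MetricSpace X] {lam C δ : ℝ} {f : ℝ → X}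
    {s : Set ℝ} (hf : IsQuasiIsometryOn lam C f s) (hC : C ≤ δ) :
    IsCoarseEmbeddingOn lam δ f s := by
  have hlam : 0 < lam := by linarith [hf.one_le]
  refine ⟨fun u hu v hv => by linarith [hf.upper u hu v hv], fun u hu v hv => ?_⟩
  have h1 := hf.lower u hu v hv
  rw [← inv_mul_le_iff₀ hlam]
  linarith

theorem IsGromovHyperbolic.nonneg {X : Type*} [MetricSpace X] {δ : ℝ}
    (hX : IsGromovHyperbolic X δ) (x : X) : 0 ≤ δ := by
  have := hX x x x x
  simp only [gromovProduct, dist_self, min_self] at this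
  linarith

theorem IsGromovHyperbolic.mono {X : Type*} [MetricSpace X] {δ δ' : ℝ}
    (hX : IsGromovHyperbolic X δ) (h : δ ≤ δ') : IsGromovHyperbolic X δ' :=
  fun w x y z => by linarith [hX w x y z]

theorem theorem1p1 {X : Type*} [MetricSpace X] (δ lam C : ℝ) (hX : IsGromovHyperbolic X δ)
    (Q G : Set X) (x y : X) (hQ : IsQuasiGeodesicBetween lam C Q x y)
    (hG : IsGeodesicSegmentBetween G x y) :
    Metric.hausdorffEDist Q G ≠ ⊤ ∧
      Metric.hausdorffDist Q G ≤ 92 * lam ^ 2 * (C + δ) := by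
  obtain ⟨a, b, f, hab, hf, rfl, rfl, rfl⟩ := hQ
  have hlam := hf.one_le
  have hC := hf.nonneg
  have hδ := hX.nonneg (f a)
  -- The exponential estimates divide by the hyperbolicity constant, while `C + δ` may be 0; hence
  -- the extra `ε`, removed at the end by a limit.
  have hclose : ∀ ε > (0 : ℝ), _ := fun ε hε =>
    IsCoarseEmbeddingOn.exists_dist_le (δ := C + δ + ε) (hX.mono (by linarith)) (by linarith) hlam
      hab (hf.isCoarseEmbeddingOn (by linarith)) hG
  constructor
  · obtain ⟨h1, h2⟩ := hclose 1 one_pos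
    refine ne_top_of_le_ne_top ENNReal.ofReal_ne_top
      (Metric.hausdorffEDist_le_of_mem_edist (r := ENNReal.ofReal (66 * lam ^ 2 * (C + δ + 1)))
        (fun q hq => ?_) fun p hp => ?_)
    · obtain ⟨p, hp, hd⟩ := h1 q hq
      exact ⟨p, hp, by rw [edist_dist]; exact ENNReal.ofReal_le_ofReal hd⟩
    · obtain ⟨q, hq, hd⟩ := h2 p hp
      exact ⟨q, hq, by rw [edist_dist]; exact ENNReal.ofReal_le_ofReal hd⟩
  · have h66 : Metric.hausdorffDist (f '' Set.Icc a b) G ≤ 66 * lam ^ 2 * (C + δ) := by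
      refine le_of_forall_pos_le_add fun ε hε => ?_
      obtain ⟨h1, h2⟩ := hclose (ε / (66 * lam ^ 2)) (by positivity)
      refine (Metric.hausdorffDist_le_of_mem_dist (by positivity) h1 h2).trans (le_of_eq ?_)
      field_simp
    refine h66.trans ?_
    gcongr
    norm_num
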